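/- Let $\mathcal H$ be a complex Hilbert space (inner product linear in the second argument). For a unitary operator $K$ on $\mathcal H$ and an operator $T$ in $\mathcal H$, let $K^*TK$ be the operator with its natural domain $\mathcal D(K^*TK)=\{f\in\mathcal H : Kf\in\mathcal D(T)\}$; a densely defined closable operator $T$ is called $K$-invariant if $K^*TK=T$, including equality of domains. Let $S$ be a densely defined, closed, symmetric operator in $\mathcal H$ that is strictly positive, i.e. $\langle f,Sf\rangle\ge\varepsilon\|f\|^2$ for all $f\in\mathcal D(S)$ and some $\varepsilon>0$. Let $S_F$ be its Friedrichs extension, i.e. the restriction of $S^*$ to those $f\in\mathcal D(S^*)$ for which there are $f_n\in\mathcal D(S)$ with $f_n\to f$ and $\langle f_n-f_m,S(f_n-f_m)\rangle\to0$ as $n,m\to\infty$. Let $B$ be a linear operator with $\overline{\mathcal D(B)}\subseteq\ker(S^*)$ that is a nonnegative self-adjoint operator or a maximally dissipative operator in the Hilbert space $\overline{\mathcal D(B)}$. Here a densely defined operator $A$ is called dissipative if $\operatorname{Im}\langle f,Af\rangle\ge0$ for all $f\in\mathcal D(A)$, and maximally dissipative if moreover it has no nontrivial dissipative extension. Let $S_B$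 be the restriction of $S^*$ to $$\mathcal D(S_B)=\mathcal D(S)\,\dot+\,\{S_F^{-1}Bf+f : f\in\mathcal D(B)\}\,\dot+\,\{S_F^{-1}\eta : \eta\in\mathcal D(B)^\perp\cap\ker(S^*)\}.$$ Let $K$ be a unitary operator on $\mathcal H$ such that $S$ is $K$-invariant. Then $S_B$ is $K$-invariant if and only if $\mathcal D(B)=\mathcal D(K^*BK)$ and $K^*BK=B$. -/

import Mathlib

open Filter Topology

namespace UnboundedOp

noncomputable section

variable {E : Type*} [NormedAddCommGroup E] [InnerProductSpace ℂ E]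

/-- The kernel of a partially defined operator, as a subspace of the whole space. -/
def ker (T : E →ₗ.[ℂ] E) : Submodule ℂ E :=
  (LinearMap.ker T.toFun).map T.domain.subtype

/-- `T` is densely defined and symmetric: `⟪T f, g⟫ = ⟪f, T g⟫` for `f, g` in the domain. -/
structure IsSymmetric (T : E →ₗ.[ℂ] E) : Prop where
  dense : Dense (T.domain : Set E)
  symm : T.IsFormalAdjoint T

/-- `T` is a nonnegative symmetric operator. -/
structure IsNonnegSymmetric (T : E →ₗ.[ℂ] E) : Prop extends IsSymmetric T where
  nonneg : ∀ f : T.domain, 0 ≤ (inner ℂ (f : E) (T f)).re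

/-- `T` is a strictly positive symmetric operator: `⟪f, T f⟫ ≥ ε ‖f‖²` for some `ε > 0`.
(The inner product is real because `T` is symmetric.) -/
structure IsStrictlyPositive (T : E →ₗ.[ℂ] E) : Prop extends IsSymmetric T where
  pos : ∃ ε : ℝ, 0 < ε ∧ ∀ f : T.domain, ε * ‖(f : E)‖ ^ 2 ≤ (inner ℂ (f : E) (T f)).re

theorem IsStrictlyPositive.isNonnegSymmetric {T : E →ₗ.[ℂ] E} (hT : IsStrictlyPositive T) :
    IsNonnegSymmetric T where
  toIsSymmetric := hT.toIsSymmetric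
  nonneg f := by
    obtain ⟨ε, hε, h⟩ := hT.pos
    exact le_trans (by positivity) (h f)

/-- `T` is dissipative: densely defined, with `Im ⟪f, T f⟫ ≥ 0` for all `f` in the domain. -/
structure IsDissipative (T : E →ₗ.[ℂ] E) : Prop where
  dense : Dense (T.domain : Set E)
  im_nonneg : ∀ f : T.domain, 0 ≤ (inner ℂ (f : E) (T f)).im

/-- `T` is dissipative and has no nontrivial dissipative extension. -/
structure IsMaximallyDissipative (T : E →ₗ.[ℂ] E) : Prop extends IsDissipative T where
  maximal : ∀ T' : E →ₗ.[ℂ] E, IsDissipative T' → T ≤ T' → T' = T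

/-- `T` is self-adjoint (in particular densely defined) and nonnegative. -/
structure IsNonnegSelfAdjoint [CompleteSpace E] (T : E →ₗ.[ℂ] E) : Prop where
  selfAdjoint : IsSelfAdjoint T
  nonneg : ∀ f : T.domain, 0 ≤ (inner ℂ (f : E) (T f)).re

/-- An operator `B` whose values lie in the closure of its domain, regarded as a (densely defined)
operator in the Hilbert space `closure (D(B))`. -/
def inClosure (B : E →ₗ.[ℂ] E) (hB : ∀ f : B.domain, B f ∈ B.domain.topologicalClosure) :
    B.domain.topologicalClosure →ₗ.[ℂ] B.domain.topologicalClosure where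
  domain := B.domain.comap B.domain.topologicalClosure.subtype
  toFun :=
    { toFun := fun f => ⟨B ⟨f.1.1, f.2⟩, hB _⟩
      map_add' := fun f g => Subtype.ext (B.map_add ⟨f.1.1, f.2⟩ ⟨g.1.1, g.2⟩)
      map_smul' := fun c f => Subtype.ext (B.map_smul c ⟨f.1.1, f.2⟩) }

variable [CompleteSpace E]

/-- The operator `K* T K` on its natural domain `{f | K f ∈ D(T)}`. -/
def conj (K : E →L[ℂ] E) (T : E →ₗ.[ℂ] E) : E →ₗ.[ℂ] E where
  domain := T.domain.comap (K : E →ₗ[ℂ] E)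
  toFun :=
    { toFun := fun f => ContinuousLinearMap.adjoint K (T ⟨K f, f.2⟩)
      map_add' := fun f g => by
        rw [← map_add, ← T.map_add]
        congr 2
        exact Subtype.ext (map_add K f.1 g.1)
      map_smul' := fun c f => by
        rw [RingHom.id_apply, ← map_smul, ← T.map_smul]
        congr 2
        exact Subtype.ext (map_smul K c f.1) }

/-- `T` is `K`-invariant: `K` is bounded and boundedly invertible, `T` is densely defined and
closable, and `K* T K = T` (equality of operators, including equality of domains). -/
structure IsInvariant (K : E →L[ℂ] E) (T : E →ₗ.[ℂ] E) : Prop where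
  invertible : IsUnit K
  dense : Dense (T.domain : Set E)
  closable : T.IsClosable
  conj_eq : conj K T = T

/-- The domain of the Friedrichs extension of a nonnegative symmetric operator `S`: all
`f ∈ D(S*)` that are limits of a sequence `uₙ ∈ D(S)` with `⟪uₙ - uₘ, S (uₙ - uₘ)⟫ → 0`
as `n, m → ∞`. -/
def friedrichsDomain (S : E →ₗ.[ℂ] E) (hS : IsNonnegSymmetric S) : Submodule ℂ E where
  carrier := {f | f ∈ S.adjoint.domain ∧ ∃ u : ℕ → S.domain,
    Tendsto (fun n => (u n : E)) atTop (𝓝 f) ∧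
    Tendsto (fun p : ℕ × ℕ => inner ℂ ((u p.1 - u p.2 : S.domain) : E) (S (u p.1 - u p.2)))
      atTop (𝓝 0)}
  zero_mem' := ⟨zero_mem _, fun _ => 0, by simp, by simp⟩
  add_mem' := by
    rintro f g ⟨hf, u, hu, hu'⟩ ⟨hg, v, hv, hv'⟩
    refine ⟨add_mem hf hg, fun n => u n + v n, by simpa using hu.add hv, ?_⟩
    have him : ∀ x : S.domain, (inner ℂ (x : E) (S x)).im = 0 := fun x => by
      have h := hS.symm x x
      rw [← inner_conj_symm] at h
      exact Complex.conj_eq_iff_im.mp h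
    have key : ∀ x y : S.domain, ‖inner ℂ ((x + y : S.domain) : E) (S (x + y))‖ ≤
        2 * ‖inner ℂ (x : E) (S x)‖ + 2 * ‖inner ℂ (y : E) (S y)‖ := fun x y => by
      have hn : ∀ z : S.domain, ‖inner ℂ (z : E) (S z)‖ = (inner ℂ (z : E) (S z)).re := fun z => by
        rw [← Complex.abs_re_eq_norm.mpr (him z), abs_of_nonneg (hS.nonneg z)]
      have hp : inner ℂ ((x + y : S.domain) : E) (S (x + y)) +
          inner ℂ ((x - y : S.domain) : E) (S (x - y)) =
          2 * inner ℂ (x : E) (S x) + 2 * inner ℂ (y : E) (S y) := by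
        simp only [S.map_add, S.map_sub, Submodule.coe_add, Submodule.coe_sub, inner_add_left,
          inner_add_right, inner_sub_left, inner_sub_right]
        ring
      have hr := congrArg Complex.re hp
      simp only [Complex.add_re, Complex.mul_re, Complex.re_ofNat, Complex.im_ofNat, zero_mul,
        sub_zero] at hr
      rw [hn, hn, hn]
      linarith [hS.nonneg (x - y)]
    have h0 := ((hu'.norm.const_mul 2).add (hv'.norm.const_mul 2))
    simp only [norm_zero, mul_zero, add_zero] at h0
    refine squeeze_zero_norm (fun p => ?_) h0
    rw [add_sub_add_comm]
    exact key _ _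
  smul_mem' := by
    rintro c f ⟨hf, u, hu, hu'⟩
    refine ⟨Submodule.smul_mem _ c hf, fun n => c • u n, by simpa using hu.const_smul c, ?_⟩
    have h := (hu'.const_mul (c * (starRingEnd ℂ) c))
    rw [mul_zero] at h
    refine h.congr fun p => ?_
    rw [← smul_sub, S.map_smul, Submodule.coe_smul, inner_smul_left, inner_smul_right]
    ring

/-- The Friedrichs extension `S_F`: the restriction of `S*` to `friedrichsDomain`. -/
def friedrichs (S : E →ₗ.[ℂ] E) (hS : IsNonnegSymmetric S) : E →ₗ.[ℂ] E :=
  S.adjoint.domRestrict (friedrichsDomain S hS)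

/-- The subspace `{S_F⁻¹ B f + f | f ∈ D(B)}`; here `g = S_F⁻¹ B f` is written as
`(B f, g) ∈ graph (S_F⁻¹)`. -/
def graphPart (S : E →ₗ.[ℂ] E) (hS : IsNonnegSymmetric S) (B : E →ₗ.[ℂ] E) : Submodule ℂ E where
  carrier := {x | ∃ (f : B.domain) (g : E),
    (B f, g) ∈ (friedrichs S hS).inverse.graph ∧ x = g + f}
  zero_mem' := ⟨0, 0, by rw [B.map_zero]; exact zero_mem _, by simp⟩
  add_mem' := by
    rintro x y ⟨f, g, hg, rfl⟩ ⟨f', g', hg', rfl⟩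
    refine ⟨f + f', g + g', ?_, by rw [Submodule.coe_add]; abel⟩
    rw [B.map_add]
    exact add_mem hg hg'
  smul_mem' := by
    rintro c x ⟨f, g, hg, rfl⟩
    refine ⟨c • f, c • g, ?_, by rw [Submodule.coe_smul, smul_add]⟩
    rw [B.map_smul]
    exact Submodule.smul_mem _ c hg

/-- The subspace `{S_F⁻¹ η | η ∈ D(B)ᗮ ∩ ker S*}`. -/
def orthogonalPart (S : E →ₗ.[ℂ] E) (hS : IsNonnegSymmetric S) (B : E →ₗ.[ℂ] E) :
    Submodule ℂ E where
  carrier := {x | ∃ η ∈ B.domainᗮ ⊓ ker S.adjoint, (η, x) ∈ (friedrichs S hS).inverse.graph}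
  zero_mem' := ⟨0, zero_mem _, zero_mem _⟩
  add_mem' := by
    rintro x y ⟨η, hη, hx⟩ ⟨η', hη', hy⟩
    exact ⟨η + η', add_mem hη hη', add_mem hx hy⟩
  smul_mem' := by
    rintro c x ⟨η, hη, hx⟩
    exact ⟨c • η, Submodule.smul_mem _ c hη, Submodule.smul_mem _ c hx⟩

/-- The extension `S_B` of `S` with auxiliary operator `B`: the restriction of `S*` to
`D(S) ∔ {S_F⁻¹ B f + f | f ∈ D(B)} ∔ {S_F⁻¹ η | η ∈ D(B)ᗮ ∩ ker S*}`. -/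
def extension (S : E →ₗ.[ℂ] E) (hS : IsNonnegSymmetric S) (B : E →ₗ.[ℂ] E) : E →ₗ.[ℂ] E :=
  S.adjoint.domRestrict (S.domain ⊔ graphPart S hS B ⊔ orthogonalPart S hS B)

/-- `B` is an admissible auxiliary operator for `S`: `closure (D(B)) ⊆ ker S*`, and `B` is a
nonnegative self-adjoint or a maximally dissipative operator in the Hilbert space
`closure (D(B))`. -/
structure IsAuxiliary (S B : E →ₗ.[ℂ] E) : Prop where
  le_ker : B.domain.topologicalClosure ≤ ker S.adjoint
  maps : ∀ f : B.domain, B f ∈ B.domain.topologicalClosure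
  nonnegSelfAdjoint_or_maximallyDissipative :
    IsNonnegSelfAdjoint (inClosure B maps) ∨ IsMaximallyDissipative (inClosure B maps)

end

end UnboundedOp

/-! For unitary `K`, `K* T K = T` says that both `K` and `K*` map the graph of `T` into itself. This
property passes from `S` to `S*`, and to `S_F`, because `K` preserves the form `⟪u, S u⟫`. If `B`
has it too, `K` and `K*` preserve each summand of `D(S_B)`.

Conversely, for `f ∈ D(B)` write `K (S_F⁻¹ B f + f) = s + (S_F⁻¹ B f' + f') + S_F⁻¹ η`. Everything
except `K f` and `f'` lies in `D(S_F)`, so `f' - K f ∈ D(S_F) ∩ ker S* = 0`. Applying `S_F` gives `K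
B f = S s + B K f + η`. Here `S s` lies in `ker S* = (ran S)ᗮ`, so it vanishes; `η` is orthogonal to
`D(B)` but also in its closure, so it vanishes as well. Hence `K B f = B K f`.

Strict positivity enters through two facts about `S_F`: `D(S_F) ∩ ker S* = 0` and surjectivity, the
latter by minimizing a quadratic functional. -/

namespace UnboundedOp

/-! ### Operators whose graph is preserved by `K` -/

section Intertwining

variable {E : Type*} [NormedAddCommGroup E] [InnerProductSpace ℂ E]

/-- `K` maps the graph of `T` into itself: `T K ⊇ K T`. -/
def Intertwines (K : E →L[ℂ] E) (T : E →ₗ.[ℂ] E) : Prop :=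
  ∀ ⦃x y : E⦄, (x, y) ∈ T.graph → (K x, K y) ∈ T.graph

theorem mem_graph_domRestrict {T : E →ₗ.[ℂ] E} {V : Submodule ℂ E} {x y : E} :
    (x, y) ∈ (T.domRestrict V).graph ↔ x ∈ V ∧ (x, y) ∈ T.graph := by
  simp only [LinearPMap.mem_graph_iff]
  constructor
  · rintro ⟨⟨z, hz⟩, rfl, h⟩
    exact ⟨hz.1, ⟨z, hz.2⟩, rfl, h⟩
  · rintro ⟨hx, ⟨z, hz⟩, rfl, h⟩
    exact ⟨⟨z, hx, hz⟩, rfl, h⟩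

theorem mem_ker_iff {T : E →ₗ.[ℂ] E} {x : E} : x ∈ ker T ↔ (x, 0) ∈ T.graph := by
  simp only [ker, Submodule.mem_map, LinearMap.mem_ker, LinearPMap.mem_graph_iff]
  exact ⟨fun ⟨y, hy, h⟩ => ⟨y, h, hy⟩, fun ⟨y, h, hy⟩ => ⟨y, hy, h⟩⟩

theorem Intertwines.mem_domain {K : E →L[ℂ] E} {T : E →ₗ.[ℂ] E} (h : Intertwines K T) {x : E}
    (hx : x ∈ T.domain) : K x ∈ T.domain :=
  LinearPMap.mem_domain_of_mem_graph (h (T.mem_graph ⟨x, hx⟩))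

theorem Intertwines.apply {K : E →L[ℂ] E} {T : E →ₗ.[ℂ] E} (h : Intertwines K T) (x : T.domain) :
    T ⟨K x, h.mem_domain x.2⟩ = K (T x) :=
  T.mem_graph_snd_inj (T.mem_graph ⟨K x, h.mem_domain x.2⟩) (h (T.mem_graph x)) rfl

theorem Intertwines.mem_ker {K : E →L[ℂ] E} {T : E →ₗ.[ℂ] E} (h : Intertwines K T) {x : E}
    (hx : x ∈ ker T) : K x ∈ ker T := by
  rw [mem_ker_iff] at hx ⊢
  simpa using h hx

variable [CompleteSpace E]

theorem star_apply_apply {K : E →L[ℂ] E} (hK : K ∈ unitary (E →L[ℂ] E)) (x : E) :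
    star K (K x) = x :=
  DFunLike.congr_fun (Unitary.star_mul_self_of_mem hK) x

theorem apply_star_apply {K : E →L[ℂ] E} (hK : K ∈ unitary (E →L[ℂ] E)) (x : E) :
    K (star K x) = x :=
  DFunLike.congr_fun (Unitary.mul_star_self_of_mem hK) x

theorem mem_graph_conj {K : E →L[ℂ] E} (hK : K ∈ unitary (E →L[ℂ] E)) {T : E →ₗ.[ℂ] E} {x y : E} :
    (x, y) ∈ (conj K T).graph ↔ (K x, K y) ∈ T.graph := by
  simp only [LinearPMap.mem_graph_iff]
  constructor
  · rintro ⟨⟨z, hz⟩, rfl, rfl⟩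
    exact ⟨⟨K z, hz⟩, rfl, (apply_star_apply hK _).symm⟩
  · rintro ⟨⟨z, hz⟩, rfl, h⟩
    refine ⟨⟨x, hz⟩, rfl, ?_⟩
    change star K (T ⟨K x, hz⟩) = y
    rw [h, star_apply_apply hK]

theorem conj_eq_iff {K : E →L[ℂ] E} (hK : K ∈ unitary (E →L[ℂ] E)) {T : E →ₗ.[ℂ] E} :
    conj K T = T ↔ Intertwines K T ∧ Intertwines (star K) T := by
  constructor
  · intro h
    have key : ∀ x y, (x, y) ∈ T.graph ↔ (K x, K y) ∈ T.graph := fun x y => by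
      rw [← mem_graph_conj hK, h]
    refine ⟨fun x y hx => (key x y).1 hx, fun x y hx => (key _ _).2 ?_⟩
    rwa [apply_star_apply hK, apply_star_apply hK]
  · rintro ⟨h, h'⟩
    refine LinearPMap.eq_of_eq_graph (Submodule.ext fun ⟨x, y⟩ => ?_)
    rw [mem_graph_conj hK]
    refine ⟨fun hx => ?_, fun hx => h hx⟩
    simpa only [star_apply_apply hK] using h' hx

theorem mem_graph_adjoint_iff {T : E →ₗ.[ℂ] E} (hT : Dense (T.domain : Set E)) {x y : E} :
    (x, y) ∈ T.adjoint.graph ↔ ∀ v : T.domain, inner ℂ (T v) x = inner ℂ (v : E) y := by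
  rw [LinearPMap.adjoint_graph_eq_graph_adjoint hT, Submodule.mem_adjoint_iff]
  constructor
  · exact fun h v => sub_eq_zero.1 (h v (T v) (T.mem_graph v))
  · rintro h a b hab
    obtain ⟨v, rfl, rfl⟩ := (LinearPMap.mem_graph_iff _).1 hab
    exact sub_eq_zero.2 (h v)

/-- Moving `K` across the inner product turns it into `K*`, which must then pass through `T`; hence
the star in the hypothesis. -/
theorem Intertwines.adjoint {K : E →L[ℂ] E} {T : E →ₗ.[ℂ] E} (hT : Dense (T.domain : Set E))
    (h : Intertwines (star K) T) : Intertwines K T.adjoint := by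
  intro x y hxy
  rw [mem_graph_adjoint_iff hT] at hxy ⊢
  intro v
  have := hxy ⟨_, h.mem_domain v.2⟩
  rw [h.apply] at this
  simpa only [ContinuousLinearMap.star_eq_adjoint, ContinuousLinearMap.adjoint_inner_left]
    using this

end Intertwining

/-! ### The Friedrichs extension: invariance, injectivity, surjectivity -/

section Friedrichs

variable {E : Type*} [NormedAddCommGroup E] [InnerProductSpace ℂ E] [CompleteSpace E]

theorem IsSymmetric.mem_graph_adjoint {S : E →ₗ.[ℂ] E} (hS : IsSymmetric S) (v : S.domain) :
    ((v : E), S v) ∈ S.adjoint.graph :=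
  (mem_graph_adjoint_iff hS.dense).2 fun w => hS.symm w v

theorem mem_graph_friedrichs {S : E →ₗ.[ℂ] E} (hS : IsNonnegSymmetric S) {x y : E} :
    (x, y) ∈ (friedrichs S hS).graph ↔ x ∈ friedrichsDomain S hS ∧ (x, y) ∈ S.adjoint.graph :=
  mem_graph_domRestrict

theorem domain_le_friedrichsDomain {S : E →ₗ.[ℂ] E} (hS : IsNonnegSymmetric S) :
    S.domain ≤ friedrichsDomain S hS := fun x hx =>
  ⟨LinearPMap.mem_domain_of_mem_graph (hS.mem_graph_adjoint ⟨x, hx⟩), fun _ => ⟨x, hx⟩,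
    tendsto_const_nhds, by simp⟩

theorem Intertwines.friedrichs {K : E →L[ℂ] E} (hK : K ∈ unitary (E →L[ℂ] E)) {S : E →ₗ.[ℂ] E}
    (hS : IsNonnegSymmetric S) (h : Intertwines K S) (h' : Intertwines (star K) S) :
    Intertwines K (friedrichs S hS) := by
  intro x y hxy
  rw [mem_graph_friedrichs] at hxy ⊢
  obtain ⟨⟨hx, u, hu, hq⟩, hg⟩ := hxy
  have hadj := h'.adjoint hS.dense
  refine ⟨⟨hadj.mem_domain hx, fun n => ⟨K (u n), h.mem_domain (u n).2⟩,
    (K.continuous.tendsto x).comp hu, hq.congr fun p => ?_⟩, hadj hg⟩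
  rw [S.map_sub, S.map_sub, h.apply, h.apply, Submodule.coe_sub, Submodule.coe_sub, ← map_sub,
    ← map_sub, ContinuousLinearMap.inner_map_map_of_mem_unitary hK]

/-- Zero is not an eigenvalue of the Friedrichs extension of a strictly positive operator. -/
theorem IsStrictlyPositive.eq_zero_of_mem_friedrichsDomain {S : E →ₗ.[ℂ] E}
    (hS : IsStrictlyPositive S) {x : E} (hx : x ∈ friedrichsDomain S hS.isNonnegSymmetric)
    (hx0 : x ∈ ker S.adjoint) : x = 0 := by
  obtain ⟨ε, hε, hpos⟩ := hS.pos
  obtain ⟨-, u, hu, hq⟩ := hx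
  rw [mem_ker_iff, mem_graph_adjoint_iff hS.dense] at hx0
  have hlim : Tendsto (fun m => ε * ‖(u m : E)‖ ^ 2) atTop (𝓝 (ε * ‖x‖ ^ 2)) :=
    (hu.norm.pow 2).const_mul ε
  have hle : ε * ‖x‖ ^ 2 ≤ 0 := by
    -- Expand the form at `u n - u m`. With `m` fixed and `n → ∞`, the cross term tends to `2 Re ⟪S
    -- u_m, x⟫ = 0`; dropping `⟪u_n, S u_n⟫ ≥ 0` leaves `ε ‖u_m‖² ≤ δ`. Then `m → ∞`.
    refine le_of_forall_pos_le_add fun δ hδ => ?_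
    rw [zero_add]
    have hev := (Complex.continuous_re.tendsto 0).comp hq
    have hev : ∀ᶠ p : ℕ × ℕ in atTop ×ˢ atTop,
        (inner ℂ ((u p.1 - u p.2 : S.domain) : E) (S (u p.1 - u p.2))).re < δ := by
      rw [prod_atTop_atTop_eq]
      exact hev.eventually (gt_mem_nhds (by simpa using hδ))
    refine le_of_tendsto hlim ?_
    filter_upwards [hev.curry] with m hm
    have hcross : Tendsto (fun n => δ + 2 * (inner ℂ (S (u m)) (u n : E)).re) atTop (𝓝 δ) := by
      have h1 : Tendsto (fun n => inner ℂ (S (u m)) (u n : E)) atTop (𝓝 0) := by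
        have := (tendsto_const_nhds (x := S (u m))).inner (𝕜 := ℂ) hu
        rwa [hx0, inner_zero_right] at this
      simpa using ((Complex.continuous_re.tendsto 0).comp h1).const_mul 2 |>.const_add δ
    refine ge_of_tendsto hcross ?_
    filter_upwards [hm] with n hn
    have e1 : (inner ℂ (u n : E) (S (u m))).re = (inner ℂ (S (u m)) (u n : E)).re := by
      rw [← inner_conj_symm, Complex.conj_re]
    have e2 : (inner ℂ (u m : E) (S (u n))).re = (inner ℂ (S (u m)) (u n : E)).re := by
      rw [hS.symm (u m) (u n)]
    simp only [S.map_sub, Submodule.coe_sub, inner_sub_left, inner_sub_right, Complex.sub_re,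
      e1, e2] at hn
    have := hpos (u m)
    have := hpos (u n)
    nlinarith [sq_nonneg ‖(u n : E)‖]
  have : ‖x‖ ^ 2 ≤ 0 := nonpos_of_mul_nonpos_right hle hε
  exact norm_eq_zero.1 (pow_eq_zero_iff two_ne_zero |>.1 (le_antisymm this (sq_nonneg _)))

theorem IsStrictlyPositive.mem_graph_inverse_friedrichs {S : E →ₗ.[ℂ] E}
    (hS : IsStrictlyPositive S) {x y : E} :
    (y, x) ∈ (friedrichs S hS.isNonnegSymmetric).inverse.graph ↔
      (x, y) ∈ (friedrichs S hS.isNonnegSymmetric).graph := by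
  have hker : LinearMap.ker (friedrichs S hS.isNonnegSymmetric).toFun = ⊥ := by
    rw [LinearMap.ker_eq_bot']
    intro x hx
    have hg := LinearPMap.mem_graph (friedrichs S hS.isNonnegSymmetric) x
    rw [show (friedrichs S hS.isNonnegSymmetric) x = 0 from hx, mem_graph_friedrichs,
      ← mem_ker_iff] at hg
    exact Subtype.ext (hS.eq_zero_of_mem_friedrichsDomain hg.1 hg.2)
  rw [LinearPMap.inverse_graph hker]
  simp [-LinearPMap.mem_graph_iff]

theorem eq_zero_of_quadratic_nonneg {c q : ℝ} (hq : 0 ≤ q)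
    (h : ∀ t : ℝ, 0 ≤ 2 * t * c + t ^ 2 * q) : c = 0 := by
  -- Nearly the minimizer `-c / q`; the shift by 1 covers `q = 0`.
  have h1 := h (-c / (q + 1))
  have hq1 : 0 < q + 1 := by linarith
  have h2 : 2 * (-c / (q + 1)) * c + (-c / (q + 1)) ^ 2 * q = -(c ^ 2 * (q + 2)) / (q + 1) ^ 2 := by
    field_simp
    ring
  rw [h2, le_div_iff₀ (by positivity)] at h1
  have : c ^ 2 = 0 := by nlinarith [sq_nonneg c]
  exact pow_eq_zero_iff two_ne_zero |>.1 this

/-- The Friedrichs extension of a strictly positive operator is onto: the preimage of `h` is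
the limit of a minimizing sequence of `v ↦ ⟪v, S v⟫ - 2 Re ⟪h, v⟫`. -/
theorem IsStrictlyPositive.exists_mem_graph_friedrichs {S : E →ₗ.[ℂ] E}
    (hS : IsStrictlyPositive S) (h : E) :
    ∃ x, (x, h) ∈ (friedrichs S hS.isNonnegSymmetric).graph := by
  obtain ⟨ε, hε, hpos⟩ := hS.pos
  set q : S.domain → ℝ := fun v => (inner ℂ (v : E) (S v)).re with hqdef
  set J : S.domain → ℝ := fun v => q v - 2 * (inner ℂ h (v : E)).re with hJdef
  have hqnn : ∀ v, 0 ≤ q v := hS.isNonnegSymmetric.nonneg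
  have hsymm : ∀ v w : S.domain, (inner ℂ (v : E) (S w)).re = (inner ℂ (S w) (v : E)).re :=
    fun v w => by rw [← inner_conj_symm, Complex.conj_re]
  have hsymm' : ∀ v w : S.domain, (inner ℂ (v : E) (S w)).re = (inner ℂ (S v) (w : E)).re :=
    fun v w => by rw [hS.symm v w]
  have hbdd : BddBelow (Set.range J) := by
    -- The minimum of `ε r² - 2 ‖h‖ r` over real `r`.
    refine ⟨-(‖h‖ ^ 2 / ε), ?_⟩
    rintro _ ⟨v, rfl⟩
    have h1 : (inner ℂ h (v : E)).re ≤ ‖h‖ * ‖(v : E)‖ :=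
      (Complex.re_le_norm _).trans (norm_inner_le_norm _ _)
    have h2 : 0 ≤ (ε * ‖(v : E)‖ - ‖h‖) ^ 2 / ε := by positivity
    have h3 : (ε * ‖(v : E)‖ - ‖h‖) ^ 2 / ε =
        ε * ‖(v : E)‖ ^ 2 - 2 * (‖h‖ * ‖(v : E)‖) + ‖h‖ ^ 2 / ε := by
      field_simp
      ring
    have := hpos v
    simp only [hJdef, hqdef]
    linarith
  obtain ⟨a, -, ha, haJ⟩ := exists_seq_tendsto_sInf (Set.range_nonempty J) hbdd
  choose u hu using haJ
  set m := sInf (Set.range J)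
  have hm : ∀ v, m ≤ J v := fun v => csInf_le hbdd ⟨v, rfl⟩
  have hJu : Tendsto (fun n => J (u n)) atTop (𝓝 m) := by simpa only [hu] using ha
  have hline : ∀ (v w : S.domain) (t : ℝ), J (v + (t : ℂ) • w) =
      J v + (2 * t * ((inner ℂ (S w) (v : E)).re - (inner ℂ h (w : E)).re) + t ^ 2 * q w) := by
    intro v w t
    have e1 := hsymm v w
    have e2 := hsymm' w v
    simp only [hJdef, hqdef, S.map_add, S.map_smul, Submodule.coe_add, Submodule.coe_smul,
      inner_add_left, inner_add_right, inner_smul_left, inner_smul_right, Complex.add_re,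
      Complex.conj_ofReal, Complex.re_ofReal_mul, e1, e2]
    ring
  have hpar : ∀ v w : S.domain, q (v - w) ≤ 2 * (J v - m) + 2 * (J w - m) := by
    intro v w
    -- At the midpoint `J` equals `(J v + J w) / 2 - q (v - w) / 4`, and this is at least `m`.
    have e := hm (v + ((1 / 2 : ℝ) : ℂ) • (w - v))
    rw [hline] at e
    have e1 := hsymm v w
    have e2 := hsymm' w v
    have e3 := hsymm v v
    simp only [hJdef, hqdef, S.map_sub, Submodule.coe_sub, inner_sub_left, inner_sub_right,
      Complex.sub_re] at e ⊢
    linarith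
  have hq0 : Tendsto (fun p : ℕ × ℕ => q (u p.1 - u p.2)) atTop (𝓝 0) := by
    rw [← prod_atTop_atTop_eq]
    have h0 : Tendsto (fun n => 2 * (J (u n) - m)) atTop (𝓝 0) := by
      simpa using (hJu.sub_const m).const_mul 2
    have h1 := (h0.comp tendsto_fst).add (h0.comp (tendsto_snd (f := atTop (α := ℕ))))
    rw [add_zero] at h1
    exact squeeze_zero (fun p => hqnn _) (fun p => hpar _ _) h1
  have hqc : Tendsto (fun p : ℕ × ℕ => inner ℂ ((u p.1 - u p.2 : S.domain) : E)
      (S (u p.1 - u p.2))) atTop (𝓝 0) := by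
    have := (Complex.continuous_ofReal.tendsto 0).comp hq0
    rw [Complex.ofReal_zero] at this
    refine this.congr fun p => ?_
    have h1 := hS.symm (u p.1 - u p.2) (u p.1 - u p.2)
    rw [← inner_conj_symm] at h1
    exact Complex.conj_eq_iff_re.1 h1
  have hcau : CauchySeq fun n => (u n : E) := by
    rw [cauchySeq_iff_tendsto_dist_atTop_0]
    have h1 : Tendsto (fun p : ℕ × ℕ => √(q (u p.1 - u p.2) / ε)) atTop (𝓝 0) := by
      simpa using (hq0.div_const ε).sqrt
    refine squeeze_zero (fun p => dist_nonneg) (fun p => ?_) h1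
    rw [dist_eq_norm]
    refine Real.le_sqrt_of_sq_le ?_
    rw [le_div_iff₀ hε, mul_comm]
    exact hpos (u p.1 - u p.2)
  obtain ⟨x, hx⟩ := cauchySeq_tendsto_of_complete hcau
  have hre : ∀ v : S.domain, (inner ℂ (S v) x).re = (inner ℂ (v : E) h).re := by
    intro v
    have hc : (inner ℂ (S v) x).re - (inner ℂ h (v : E)).re = 0 := by
      -- Euler equation: let `n → ∞` in `J (u n + t v) - m ≥ 0`. As `J (u n) → m`, the functional
      -- need not be defined at `x`.
      refine eq_zero_of_quadratic_nonneg (hqnn v) fun t => ?_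
      have h1 : Tendsto (fun n => (inner ℂ (S v) (u n : E)).re) atTop (𝓝 (inner ℂ (S v) x).re) :=
        (Complex.continuous_re.tendsto _).comp (tendsto_const_nhds.inner hx)
      have h2 := (hJu.add (((h1.sub_const (inner ℂ h (v : E)).re).const_mul (2 * t)).add_const
        (t ^ 2 * q v))).sub_const m
      rw [add_sub_cancel_left] at h2
      refine ge_of_tendsto' h2 fun n => ?_
      rw [← hline]
      exact sub_nonneg.2 (hm _)
    rw [sub_eq_zero.1 hc, ← inner_conj_symm, Complex.conj_re]
  have hgraph : (x, h) ∈ S.adjoint.graph := by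
    rw [mem_graph_adjoint_iff hS.dense]
    intro v
    refine Complex.ext (hre v) ?_
    -- Replacing `v` by `i v` turns real parts into imaginary parts.
    have := hre (Complex.I • v)
    simpa [S.map_smul, inner_smul_left] using this
  exact ⟨x, (mem_graph_friedrichs _).2
    ⟨⟨LinearPMap.mem_domain_of_mem_graph hgraph, u, hx, hqc⟩, hgraph⟩⟩

end Friedrichs

/-! ### Transfer of invariance between `B` and `S_B` -/

section Extension

variable {E : Type*} [NormedAddCommGroup E] [InnerProductSpace ℂ E] [CompleteSpace E]

theorem IsStrictlyPositive.mem_graphPart {S : E →ₗ.[ℂ] E} (hS : IsStrictlyPositive S)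
    {B : E →ₗ.[ℂ] E} {x : E} :
    x ∈ graphPart S hS.isNonnegSymmetric B ↔ ∃ f b g : E, (f, b) ∈ B.graph ∧
      (g, b) ∈ (friedrichs S hS.isNonnegSymmetric).graph ∧ x = g + f := by
  constructor
  · rintro ⟨f, g, hg, rfl⟩
    exact ⟨f, B f, g, B.mem_graph f, hS.mem_graph_inverse_friedrichs.1 hg, rfl⟩
  · rintro ⟨f, b, g, hf, hg, rfl⟩
    obtain ⟨f, rfl, rfl⟩ := (LinearPMap.mem_graph_iff _).1 hf
    exact ⟨f, g, hS.mem_graph_inverse_friedrichs.2 hg, rfl⟩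

theorem IsStrictlyPositive.mem_orthogonalPart {S : E →ₗ.[ℂ] E} (hS : IsStrictlyPositive S)
    {B : E →ₗ.[ℂ] E} {x : E} :
    x ∈ orthogonalPart S hS.isNonnegSymmetric B ↔ ∃ η ∈ B.domainᗮ, η ∈ ker S.adjoint ∧
      (x, η) ∈ (friedrichs S hS.isNonnegSymmetric).graph := by
  constructor
  · rintro ⟨η, ⟨h, h'⟩, hx⟩
    exact ⟨η, h, h', hS.mem_graph_inverse_friedrichs.1 hx⟩
  · rintro ⟨η, h, h', hx⟩
    exact ⟨η, ⟨h, h'⟩, hS.mem_graph_inverse_friedrichs.2 hx⟩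

theorem Intertwines.mem_orthogonal {K : E →L[ℂ] E} {B : E →ₗ.[ℂ] E}
    (h : Intertwines (star K) B) {η : E} (hη : η ∈ B.domainᗮ) : K η ∈ B.domainᗮ := by
  rw [Submodule.mem_orthogonal] at hη ⊢
  intro v hv
  have := hη _ (h.mem_domain hv)
  rwa [ContinuousLinearMap.star_eq_adjoint, ContinuousLinearMap.adjoint_inner_left] at this

theorem Intertwines.extension {K : E →L[ℂ] E} (hK : K ∈ unitary (E →L[ℂ] E)) {S B : E →ₗ.[ℂ] E}
    (hS : IsStrictlyPositive S) (h : Intertwines K S) (h' : Intertwines (star K) S)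
    (hB : Intertwines K B) (hB' : Intertwines (star K) B) :
    Intertwines K (extension S hS.isNonnegSymmetric B) := by
  intro x y hxy
  have hadj := h'.adjoint hS.dense
  have hF := h.friedrichs hK hS.isNonnegSymmetric h'
  rw [UnboundedOp.extension, mem_graph_domRestrict] at hxy ⊢
  refine ⟨?_, hadj hxy.2⟩
  have hle : S.domain ⊔ graphPart S hS.isNonnegSymmetric B ⊔
      orthogonalPart S hS.isNonnegSymmetric B ≤
      (S.domain ⊔ graphPart S hS.isNonnegSymmetric B ⊔
        orthogonalPart S hS.isNonnegSymmetric B).comap (K : E →ₗ[ℂ] E) := by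
    refine sup_le (sup_le ?_ ?_) ?_
    · exact fun z hz => Submodule.mem_sup_left (Submodule.mem_sup_left (h.mem_domain hz))
    · intro z hz
      obtain ⟨f, b, g, hf, hg, rfl⟩ := hS.mem_graphPart.1 hz
      exact Submodule.mem_sup_left (Submodule.mem_sup_right
        (hS.mem_graphPart.2 ⟨K f, K b, K g, hB hf, hF hg, map_add K g f⟩))
    · intro z hz
      obtain ⟨η, hη, hη', hg⟩ := hS.mem_orthogonalPart.1 hz
      exact Submodule.mem_sup_right (hS.mem_orthogonalPart.2
        ⟨K η, hB'.mem_orthogonal hη, hadj.mem_ker hη', hF hg⟩)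
  exact hle hxy.1

theorem isClosable_extension {S : E →ₗ.[ℂ] E} (hS : IsNonnegSymmetric S) (B : E →ₗ.[ℂ] E) :
    (extension S hS B).IsClosable :=
  (LinearPMap.adjoint_isClosed hS.dense).isClosable.leIsClosable LinearPMap.domRestrict_le

theorem domain_le_domain_extension {S : E →ₗ.[ℂ] E} (hS : IsNonnegSymmetric S) (B : E →ₗ.[ℂ] E) :
    S.domain ≤ (extension S hS B).domain := fun x hx =>
  ⟨Submodule.mem_sup_left (Submodule.mem_sup_left hx),
    LinearPMap.mem_domain_of_mem_graph (hS.mem_graph_adjoint ⟨x, hx⟩)⟩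

theorem IsAuxiliary.mem_ker {S B : E →ₗ.[ℂ] E} (hB : IsAuxiliary S B) {f b : E}
    (hf : (f, b) ∈ B.graph) : f ∈ ker S.adjoint ∧ b ∈ ker S.adjoint := by
  obtain ⟨f, rfl, rfl⟩ := (LinearPMap.mem_graph_iff _).1 hf
  exact ⟨hB.le_ker (Submodule.le_topologicalClosure _ f.2), hB.le_ker (hB.maps f)⟩

/-- If `K` intertwines `S_B`, then `K` maps `D(B)` into itself, and `K B f - B K f` is
orthogonal to `D(B)`. -/
theorem exists_mem_graph_of_intertwines_extension {K : E →L[ℂ] E}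
    (hK : K ∈ unitary (E →L[ℂ] E)) {S B : E →ₗ.[ℂ] E}
    (hS : IsStrictlyPositive S) (h : Intertwines K S) (h' : Intertwines (star K) S)
    (hB : IsAuxiliary S B) (hSB : Intertwines K (extension S hS.isNonnegSymmetric B))
    {f b : E} (hf : (f, b) ∈ B.graph) :
    ∃ η ∈ B.domainᗮ, (K f, K b - η) ∈ B.graph := by
  have hadj := h'.adjoint hS.dense
  have hF := h.friedrichs hK hS.isNonnegSymmetric h'
  obtain ⟨hfk, hbk⟩ := hB.mem_ker hf
  obtain ⟨g, hg⟩ := hS.exists_mem_graph_friedrichs b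
  have hx : g + f ∈ (extension S hS.isNonnegSymmetric B).domain := by
    refine ⟨Submodule.mem_sup_left (Submodule.mem_sup_right
      (hS.mem_graphPart.2 ⟨f, b, g, hf, hg, rfl⟩)), add_mem ?_ ?_⟩
    · exact LinearPMap.mem_domain_of_mem_graph ((mem_graph_friedrichs _).1 hg).2
    · exact LinearPMap.mem_domain_of_mem_graph (mem_ker_iff.1 hfk)
  obtain ⟨z, hz, w, hw, hzw⟩ := Submodule.mem_sup.1 (hSB.mem_domain hx).1
  obtain ⟨s, hs, p, hp, rfl⟩ := Submodule.mem_sup.1 hz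
  obtain ⟨f', b', g', hf', hg', rfl⟩ := hS.mem_graphPart.1 hp
  obtain ⟨η, hη, hηk, hw⟩ := hS.mem_orthogonalPart.1 hw
  obtain ⟨hfk', hbk'⟩ := hB.mem_ker hf'
  have hsF : (s, S ⟨s, hs⟩) ∈ (friedrichs S hS.isNonnegSymmetric).graph :=
    (mem_graph_friedrichs _).2
      ⟨domain_le_friedrichsDomain _ hs, hS.mem_graph_adjoint ⟨s, hs⟩⟩
  -- Collect the terms in `D(S_F)`: their sum is also `f' - K f ∈ ker S*`, hence zero.
  have hd : (K g - s - g' - w, K b - S ⟨s, hs⟩ - b' - η) ∈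
      (friedrichs S hS.isNonnegSymmetric).graph :=
    sub_mem (sub_mem (sub_mem (hF hg) hsF) hg') hw
  rw [map_add] at hzw
  have hdf : K g - s - g' - w = f' - K f := by
    rw [eq_sub_of_add_eq hzw.symm]
    abel
  have hff : f' = K f := by
    rw [hdf] at hd
    exact sub_eq_zero.1 (hS.eq_zero_of_mem_friedrichsDomain ((mem_graph_friedrichs _).1 hd).1
      (sub_mem hfk' (hadj.mem_ker hfk)))
  rw [hdf, hff, sub_self] at hd
  have hsum : K b - S ⟨s, hs⟩ - b' - η = 0 :=
    LinearPMap.graph_fst_eq_zero_snd _ hd rfl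
  have hSs : S ⟨s, hs⟩ = K b - b' - η := by
    rw [← sub_eq_zero, ← neg_eq_zero, ← hsum]
    abel
  have hSk : S ⟨s, hs⟩ ∈ ker S.adjoint := by
    rw [hSs]
    exact sub_mem (sub_mem (hadj.mem_ker hbk) hbk') hηk
  -- `ker S*` is orthogonal to the range of `S`, so `S s` is orthogonal to itself.
  have hS0 : S ⟨s, hs⟩ = 0 := by
    have := (mem_graph_adjoint_iff hS.dense).1 (mem_ker_iff.1 hSk) ⟨s, hs⟩
    rwa [inner_zero_right, inner_self_eq_zero] at this
  refine ⟨η, hη, ?_⟩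
  have hb : K b - η = b' := by
    rw [hS0] at hSs
    rw [← sub_eq_zero, hSs]
    abel
  rwa [hb, ← hff]

/-- The defect `η` vanishes: `K` preserves `D(B)`, hence its closure, so `η = K b - B K f` lies both
in that closure and in its orthogonal complement. -/
theorem intertwines_of_intertwines_extension {K : E →L[ℂ] E}
    (hK : K ∈ unitary (E →L[ℂ] E)) {S B : E →ₗ.[ℂ] E}
    (hS : IsStrictlyPositive S) (h : Intertwines K S) (h' : Intertwines (star K) S)
    (hB : IsAuxiliary S B) (hSB : Intertwines K (extension S hS.isNonnegSymmetric B)) :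
    Intertwines K B := by
  intro f b hf
  obtain ⟨η, hη, hg⟩ := exists_mem_graph_of_intertwines_extension hK hS h h' hB hSB hf
  have hdom : ∀ v ∈ B.domain, K v ∈ B.domain := fun v hv => by
    obtain ⟨_, -, hv'⟩ :=
      exists_mem_graph_of_intertwines_extension hK hS h h' hB hSB (B.mem_graph ⟨v, hv⟩)
    exact LinearPMap.mem_domain_of_mem_graph hv'
  have hcl : ∀ {f b : E}, (f, b) ∈ B.graph → b ∈ B.domain.topologicalClosure := by
    intro f b hf
    obtain ⟨f, rfl, rfl⟩ := (LinearPMap.mem_graph_iff _).1 hf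
    exact hB.maps f
  have hKb : K b ∈ B.domain.topologicalClosure :=
    map_mem_closure K.continuous (hcl hf) hdom
  have hη' : η ∈ B.domain.topologicalClosure := by
    simpa using sub_mem hKb (hcl hg)
  rw [← Submodule.orthogonal_closure] at hη
  have h0 : η = 0 := inner_self_eq_zero.1 (Submodule.inner_right_of_mem_orthogonal hη' hη)
  rwa [h0, sub_zero] at hg

end Extension

end UnboundedOp

theorem mainTheorem9 {H : Type*} [NormedAddCommGroup H] [InnerProductSpace ℂ H] [CompleteSpace H]
    (K : H →L[ℂ] H) (hK : K ∈ unitary (H →L[ℂ] H))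
    (S : H →ₗ.[ℂ] H) (hS : UnboundedOp.IsStrictlyPositive S) (hSclosed : S.IsClosed)
    (hSK : UnboundedOp.IsInvariant K S)
    (B : H →ₗ.[ℂ] H) (hB : UnboundedOp.IsAuxiliary S B) :
    UnboundedOp.IsInvariant K (UnboundedOp.extension S hS.isNonnegSymmetric B) ↔
      B.domain = (UnboundedOp.conj K B).domain ∧ UnboundedOp.conj K B = B := by
  have hK' : star K ∈ unitary (H →L[ℂ] H) := Unitary.star_mem hK
  obtain ⟨h, h'⟩ := (UnboundedOp.conj_eq_iff hK).1 hSK.conj_eq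
  have h'' : UnboundedOp.Intertwines (star (star K)) S := by rwa [star_star]
  constructor
  · intro hinv
    obtain ⟨hE, hE'⟩ := (UnboundedOp.conj_eq_iff hK).1 hinv.conj_eq
    have hconj : UnboundedOp.conj K B = B := (UnboundedOp.conj_eq_iff hK).2
      ⟨UnboundedOp.intertwines_of_intertwines_extension hK hS h h' hB hE,
        UnboundedOp.intertwines_of_intertwines_extension hK' hS h' h'' hB hE'⟩
    exact ⟨congrArg LinearPMap.domain hconj.symm, hconj⟩
  · rintro ⟨-, hconj⟩
    obtain ⟨hBK, hBK'⟩ := (UnboundedOp.conj_eq_iff hK).1 hconj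
    have hBK'' : UnboundedOp.Intertwines (star (star K)) B := by rwa [star_star]
    exact
      { invertible := hSK.invertible
        dense := hSK.dense.mono (UnboundedOp.domain_le_domain_extension _ _)
        closable := UnboundedOp.isClosable_extension _ _
        conj_eq := (UnboundedOp.conj_eq_iff hK).2
          ⟨h.extension hK hS h' hBK hBK', h'.extension hK' hS h'' hBK' hBK''⟩ }
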